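/- For complex $\nu,\xi$ let $J_\nu(\xi)=\sum_{m=0}^\infty \frac{(-1)^m(\xi/2)^{2m+\nu}}{m!\,\Gamma(m+1+\nu)}$ (principal branch of the power, $1/\Gamma=0$ at the poles of $\Gamma$) be the Bessel function of the first kind, and let $I_\nu(\xi)=e^{-\pi\nu i/2}J_\nu(e^{\pi i/2}\xi)$ for $-\pi<\arg\xi\le\frac{\pi}{2}$ and $I_\nu(\xi)=e^{3\pi\nu i/2}J_\nu(e^{-3\pi i/2}\xi)$ for $\frac{\pi}{2}<\arg\xi\le\pi$. For $\nu\notin\mathbb Z$ let $$Y_\nu(\xi)=\frac{J_\nu(\xi)\cos(\pi\nu)-J_{-\nu}(\xi)}{\sin(\pi\nu)},\qquad K_\nu(\xi)=\frac{\pi}{2}\,\frac{I_{-\nu}(\xi)-I_\nu(\xi)}{\sin(\pi\nu)},$$ and for an integer $n$ let $Y_n(\xi)=\lim_{\nu\to n}Y_\nu(\xi)$ and $K_n(\xi)=\lim_{\nu\to n}K_\nu(\xi)$. Put $M_\nu(\xi)=\frac{2}{\pi}K_\nu(\xi)-Y_\nu(\xi)$. Let $x>0$ and let $z\in\mathbb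 C$ with $-1<\operatorname{Re}z<1$. Then the improper integral $$H_z^{(1)}(x):=\int_0^\infty t^{z-1}\cos(xt)\cos\!\left(\frac1t\right)dt=\lim_{\substack{\varepsilon\to0^+\\ R\to\infty}}\int_\varepsilon^R t^{z-1}\cos(xt)\cos\!\left(\frac1t\right)dt$$ converges (with $\varepsilon\to 0^+$ and $R\to\infty$ independently), and $$H_z^{(1)}(x)=\frac{\pi}{2}\,x^{-z/2}\left(\cos\!\left(\tfrac12\pi z\right)M_z(2\sqrt x)-\sin\!\left(\tfrac12\pi z\right)J_z(2\sqrt x)\right).$$ -/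

import Mathlib

open Filter Topology

noncomputable section

/-- The Bessel function of the first kind `J_ν(ξ)`, given by its power series (principal branch of
the power). The convention `1 / Γ(-n) = 0` for `n = 0, 1, 2, …` is that of Mathlib's `Gamma`. -/
def besselJ (ν ξ : ℂ) : ℂ :=
  ∑' m : ℕ, (-1 : ℂ) ^ m * (ξ / 2) ^ (2 * (m : ℂ) + ν) /
    ((m.factorial : ℂ) * Complex.Gamma ((m : ℂ) + 1 + ν))

/-- The modified Bessel function of the first kind `I_ν(ξ)`: the function
`e^{-πνi/2} J_ν(e^{πi/2} ξ)` for `-π < arg ξ ≤ π/2`, and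
`e^{3πνi/2} J_ν(e^{-3πi/2} ξ)` for `π/2 < arg ξ ≤ π`. -/
def besselI (ν ξ : ℂ) : ℂ :=
  if ξ.arg ≤ Real.pi / 2 then
    Complex.exp (-(Real.pi * ν * Complex.I / 2)) *
      besselJ ν (Complex.exp (Real.pi * Complex.I / 2) * ξ)
  else
    Complex.exp (3 * Real.pi * ν * Complex.I / 2) *
      besselJ ν (Complex.exp (-(3 * Real.pi * Complex.I / 2)) * ξ)

/-- The quotient that defines `Y_ν(ξ)` for a non-integral order. -/
def besselYQuot (ν ξ : ℂ) : ℂ :=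
  (besselJ ν ξ * Complex.cos (Real.pi * ν) - besselJ (-ν) ξ) / Complex.sin (Real.pi * ν)

/-- The quotient that defines `K_ν(ξ)` for a non-integral order. -/
def besselKQuot (ν ξ : ℂ) : ℂ :=
  (Real.pi / 2) * ((besselI (-ν) ξ - besselI ν ξ) / Complex.sin (Real.pi * ν))

open Classical in
/-- The Bessel function of the second kind `Y_ν(ξ)`; at an integral order it is the limit over
complex orders tending to that integer. -/
def besselY (ν ξ : ℂ) : ℂ :=
  if ∃ n : ℤ, ν = n then limUnder (𝓝[≠] ν) (fun μ => besselYQuot μ ξ) else besselYQuot ν ξ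

open Classical in
/-- The modified Bessel function of the second kind `K_ν(ξ)`; at an integral order it is the limit
over complex orders tending to that integer. -/
def besselK (ν ξ : ℂ) : ℂ :=
  if ∃ n : ℤ, ν = n then limUnder (𝓝[≠] ν) (fun μ => besselKQuot μ ξ) else besselKQuot ν ξ

/-- `M_ν(ξ) = (2/π) K_ν(ξ) - Y_ν(ξ)`. -/
def besselM (ν ξ : ℂ) : ℂ :=
  (2 / Real.pi) * besselK ν ξ - besselY ν ξ

/-- The truncated integral `∫_ε^R t^{z-k} cos(xt) cos(1/t^k) dt`, with `p = (ε, R)`. -/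
def hardyKoshliakovPartial (k : ℕ) (z : ℂ) (x : ℝ) (p : ℝ × ℝ) : ℂ :=
  ∫ t in p.1..p.2,
    (t : ℂ) ^ (z - (k : ℂ)) * (Real.cos (x * t) : ℂ) * (Real.cos (1 / t ^ k) : ℂ)

/-- The Hardy-Koshliakov integral `H_z^{(k)}(x) = ∫_0^∞ t^{z-k} cos(xt) cos(1/t^k) dt`. It is an
improper integral at both ends (in general only conditionally convergent): the joint limit of the
truncated integrals as `ε → 0+` and `R → ∞` independently. -/
def hardyKoshliakovH (k : ℕ) (z : ℂ) (x : ℝ) : ℂ :=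
  limUnder (𝓝[>] (0 : ℝ) ×ˢ atTop) (hardyKoshliakovPartial k z x)

end

/-! The substitution `t = exp u` and Euler's formula for both cosines turn the integral into the
mean of four integrals of `exp (z u - p exp u - q exp (-u))` over the line, with `p = ± i x` and `q
= ± i`. For `p`, `q` in the open right half-plane such an integral is a Macdonald function, and for
`z ≠ 0` it equals `macdonaldSeries`, a combination of the entire Bessel-Clifford functions `F_z` and
`F_{-z}` at `p q`.

That evaluation (`macdonaldIntegral_one_ofReal`) needs no uniqueness theorem for differential
equations. Wronskians are constant: the one of the integral with `F_z` equals 1 by its limit at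
`0+`, the one of `F_z` with `F_{-z}` is a multiple of `sin (π z)`. The relations for `z` and `-z`
form a linear system that determines the integral. Scaling and the identity theorem, in each
variable in turn, extend the result to complex `p`, `q`.

The required `p`, `q` lie on the imaginary axis, where convergence is only conditional. One
integration by parts on each half-line gives `macdonaldTail`, which converges absolutely there and
is continuous up to the axis, so `macdonaldTail_add_tail_eq_series` follows by a limit. Adding the
four values leaves a trigonometric identity. At `z = 0` the series formula degenerates to `0 / 0`,
and both sides are limits from `z ≠ 0`. -/

open MeasureTheory

/-! ### The Bessel-Clifford function -/

/-- The coefficient `1 / (m! Γ(m + 1 + ν))`. -/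
noncomputable def besselCliffordCoeff (ν : ℂ) (m : ℕ) : ℂ :=
  ((m.factorial : ℂ) * Complex.Gamma ((m : ℂ) + 1 + ν))⁻¹

/-- The Bessel-Clifford function `∑ s ^ m / (m! Γ(m + 1 + ν))`. -/
noncomputable def besselClifford (ν s : ℂ) : ℂ := ∑' m : ℕ, besselCliffordCoeff ν m * s ^ m

/-- The identity `1 / Γ(s) = s / Γ(s + 1)` also holds at the poles, so no `ν` is excluded. -/
theorem besselCliffordCoeff_eq_mul (ν : ℂ) (m : ℕ) :
    besselCliffordCoeff ν m = ((m : ℂ) + 1 + ν) * besselCliffordCoeff (ν + 1) m := by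
  unfold besselCliffordCoeff
  rw [mul_inv, mul_inv, Complex.one_div_Gamma_eq_self_mul_one_div_Gamma_add_one]
  ring_nf

theorem succ_mul_besselCliffordCoeff (ν : ℂ) (m : ℕ) :
    ((m : ℂ) + 1) * besselCliffordCoeff ν (m + 1) = besselCliffordCoeff (ν + 1) m := by
  unfold besselCliffordCoeff
  have h : ((m : ℂ) + 1) ≠ 0 := by exact_mod_cast Nat.succ_ne_zero m
  rw [Nat.factorial_succ]
  push_cast
  rw [mul_assoc, mul_inv, ← mul_assoc, mul_inv_cancel₀ h, one_mul]
  ring_nf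

theorem summable_norm_besselClifford (ν s : ℂ) :
    Summable fun m : ℕ => ‖besselCliffordCoeff ν m * s ^ m‖ := by
  have hlim : Tendsto (fun m : ℕ => (m : ℝ)) atTop atTop := tendsto_natCast_atTop_atTop
  refine (summable_of_ratio_norm_eventually_le (r := 1 / 2) (by norm_num) ?_)
  -- Consecutive coefficients differ by the factor `(m + 1) (m + 1 + ν)`; beyond this threshold its
  -- modulus is at least `2 ‖s‖`, whence the ratio `1 / 2`.
  filter_upwards [hlim.eventually_ge_atTop (2 * ‖s‖ + ‖ν‖)] with m hm
  have h1 : besselCliffordCoeff ν m =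
      ((m : ℂ) + 1 + ν) * (((m : ℂ) + 1) * besselCliffordCoeff ν (m + 1)) := by
    rw [succ_mul_besselCliffordCoeff, besselCliffordCoeff_eq_mul]
  have h2 : ‖((m : ℂ) + 1)‖ = m + 1 := by
    have : ((m : ℂ) + 1) = ((m + 1 : ℝ) : ℂ) := by push_cast; ring
    rw [this, Complex.norm_of_nonneg (by positivity)]
  have h3 : 2 * ‖s‖ ≤ ‖((m : ℂ) + 1 + ν)‖ := by
    have := norm_sub_le_norm_add ((m : ℂ) + 1) ν
    linarith
  rw [norm_norm, norm_norm, h1, norm_mul, norm_mul, norm_mul, norm_mul, norm_pow, norm_pow, h2,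
    pow_succ]
  have h4 : 1 ≤ (m : ℝ) + 1 := by linarith [(Nat.cast_nonneg m : (0 : ℝ) ≤ m)]
  have h5 : 0 ≤ ‖besselCliffordCoeff ν (m + 1)‖ * ‖s‖ ^ m := by positivity
  have h6 : 2 * ‖s‖ ≤ ‖((m : ℂ) + 1 + ν)‖ * ((m : ℝ) + 1) := by nlinarith [norm_nonneg s]
  nlinarith [mul_le_mul_of_nonneg_left h6 h5]

theorem summable_besselClifford (ν s : ℂ) :
    Summable fun m : ℕ => besselCliffordCoeff ν m * s ^ m :=
  (summable_norm_besselClifford ν s).of_norm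

theorem besselClifford_zero_right (ν : ℂ) :
    besselClifford ν 0 = (Complex.Gamma (1 + ν))⁻¹ := by
  unfold besselClifford
  rw [tsum_eq_single 0 (by intro m hm; simp [hm])]
  simp [besselCliffordCoeff]

theorem hasDerivAt_besselClifford (ν s : ℂ) :
    HasDerivAt (besselClifford ν) (besselClifford (ν + 1) s) s := by
  have key : ∀ (m : ℕ) (w : ℂ), ((m + 1 : ℕ) : ℂ) * w ^ m * besselCliffordCoeff ν (m + 1) =
      besselCliffordCoeff (ν + 1) m * w ^ m := by
    intro m w
    rw [← succ_mul_besselCliffordCoeff]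
    push_cast
    ring
  have hs : Summable fun m : ℕ =>
      ‖besselCliffordCoeff ν m * ((m : ℂ) * ((‖s‖ + 1 : ℝ) : ℂ) ^ (m - 1))‖ := by
    rw [← summable_nat_add_iff 1]
    refine (summable_norm_besselClifford (ν + 1) ((‖s‖ + 1 : ℝ) : ℂ)).congr fun m => ?_
    rw [← key m]
    simp only [Nat.add_sub_cancel]
    congr 1
    ring
  have h := hasDerivAt_tsum_of_isPreconnected (𝕜 := ℂ)
    (g := fun m w => besselCliffordCoeff ν m * w ^ m)
    (g' := fun m w => besselCliffordCoeff ν m * ((m : ℂ) * w ^ (m - 1))) (y := s)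
    hs (Metric.isOpen_ball (x := (0 : ℂ)) (ε := ‖s‖ + 1))
    (convex_ball (0 : ℂ) (‖s‖ + 1)).isPreconnected
    (fun m y _ => (hasDerivAt_pow m y).const_mul _)
    (fun m y hy => by
      have hy' : ‖y‖ ≤ ‖s‖ + 1 := by simpa using (mem_ball_zero_iff.1 hy).le
      simp only [norm_mul, norm_pow, Complex.norm_real]
      rw [Real.norm_of_nonneg (show 0 ≤ ‖s‖ + 1 by positivity)]
      gcongr)
    (Metric.mem_ball_self (by positivity)) (summable_besselClifford ν 0) (by simp)
  have e : ∑' m : ℕ, besselCliffordCoeff ν m * ((m : ℂ) * s ^ (m - 1)) =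
      besselClifford (ν + 1) s := by
    rw [tsum_eq_zero_add']
    · simp only [Nat.cast_zero, zero_mul, mul_zero, zero_add, Nat.add_sub_cancel]
      unfold besselClifford
      refine tsum_congr fun m => ?_
      rw [← key]
      ring
    · refine (summable_besselClifford (ν + 1) s).congr fun m => ?_
      rw [← key]
      simp only [Nat.add_sub_cancel]
      ring
  rw [e] at h
  exact h

theorem differentiable_besselClifford (ν : ℂ) : Differentiable ℂ (besselClifford ν) :=
  fun s => (hasDerivAt_besselClifford ν s).differentiableAt

/-- Since differentiation raises the order by one, this is the differential equation `s F'' + (ν +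
1) F' = F`. -/
theorem besselClifford_recurrence (ν s : ℂ) :
    s * besselClifford (ν + 2) s + (ν + 1) * besselClifford (ν + 1) s = besselClifford ν s := by
  have h1 : s * besselClifford (ν + 2) s =
      ∑' m : ℕ, (m : ℂ) * besselCliffordCoeff (ν + 1) m * s ^ m := by
    have hk : ∀ m : ℕ, ((m + 1 : ℕ) : ℂ) * besselCliffordCoeff (ν + 1) (m + 1) * s ^ (m + 1) =
        s * (besselCliffordCoeff (ν + 2) m * s ^ m) := by
      intro m
      rw [show ν + 2 = ν + 1 + 1 by ring, ← succ_mul_besselCliffordCoeff (ν + 1)]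
      push_cast
      ring
    rw [tsum_eq_zero_add']
    · simp only [Nat.cast_zero, zero_mul, zero_add]
      simp_rw [hk]
      rw [tsum_mul_left, besselClifford]
    · simp_rw [hk]
      exact (summable_besselClifford _ _).mul_left _
  have h2 : Summable fun m : ℕ => (m : ℂ) * besselCliffordCoeff (ν + 1) m * s ^ m := by
    refine ((summable_besselClifford ν s).sub
      ((summable_besselClifford (ν + 1) s).mul_left (ν + 1))).congr fun m => ?_
    rw [besselCliffordCoeff_eq_mul ν]
    ring
  rw [h1, besselClifford, ← tsum_mul_left,
    ← h2.tsum_add ((summable_besselClifford (ν + 1) s).mul_left (ν + 1)), besselClifford]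
  refine tsum_congr fun m => ?_
  rw [besselCliffordCoeff_eq_mul ν]
  ring

theorem norm_besselCliffordCoeff_le {ν : ℂ} {a : ℝ} (ha : 0 < a) (hν : a ≤ 1 + ν.re) (m : ℕ) :
    ‖besselCliffordCoeff ν m‖ ≤ ‖(Complex.Gamma (1 + ν))⁻¹‖ * (a⁻¹ ^ m / m.factorial) := by
  induction m with
  | zero => simp [besselCliffordCoeff]
  | succ m ih =>
    have h1 : besselCliffordCoeff ν m =
        ((m : ℂ) + 1 + ν) * (((m : ℂ) + 1) * besselCliffordCoeff ν (m + 1)) := by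
      rw [succ_mul_besselCliffordCoeff, besselCliffordCoeff_eq_mul]
    have h2 : ‖((m : ℂ) + 1)‖ = m + 1 := by
      have : ((m : ℂ) + 1) = ((m + 1 : ℝ) : ℂ) := by push_cast; ring
      rw [this, Complex.norm_of_nonneg (by positivity)]
    have h3 : a ≤ ‖((m : ℂ) + 1 + ν)‖ := by
      refine le_trans ?_ (Complex.re_le_norm _)
      simp only [Complex.add_re, Complex.natCast_re, Complex.one_re]
      linarith [(Nat.cast_nonneg m : (0 : ℝ) ≤ m)]
    rw [h1, norm_mul, norm_mul, h2] at ih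
    have h4 : a * (((m : ℝ) + 1) * ‖besselCliffordCoeff ν (m + 1)‖) ≤
        ‖(Complex.Gamma (1 + ν))⁻¹‖ * (a⁻¹ ^ m / m.factorial) :=
      le_trans (by gcongr) ih
    rw [Nat.factorial_succ, pow_succ]
    push_cast
    have h5 : ‖besselCliffordCoeff ν (m + 1)‖ =
        (a * (((m : ℝ) + 1) * ‖besselCliffordCoeff ν (m + 1)‖)) * (a⁻¹ / (m + 1)) := by
      field_simp
    rw [h5]
    calc _ ≤ ‖(Complex.Gamma (1 + ν))⁻¹‖ * (a⁻¹ ^ m / m.factorial) * (a⁻¹ / (m + 1)) := by gcongr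
      _ = _ := by field_simp

theorem differentiableAt_besselClifford_order {ν : ℂ} (hν : -1 < ν.re) (s : ℂ) :
    DifferentiableAt ℂ (fun μ => besselClifford μ s) ν := by
  -- Half the distance from `ν` to the line `re = -1`, so that `1 + re μ ≥ a` on the ball of radius
  -- `a`.
  set a : ℝ := (1 + ν.re) / 2 with ha
  have ha0 : 0 < a := by linarith
  have hΓ : Continuous fun μ : ℂ => ‖(Complex.Gamma (1 + μ))⁻¹‖ :=
    (Complex.differentiable_one_div_Gamma.continuous.comp (continuous_const.add continuous_id)).norm
  obtain ⟨C, hC⟩ := (isCompact_closedBall ν a).exists_bound_of_continuousOn hΓ.continuousOn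
  have hs : Summable fun m : ℕ => C * ((a⁻¹ * ‖s‖) ^ m / m.factorial) :=
    (Real.summable_pow_div_factorial _).mul_left C
  have hd : DifferentiableOn ℂ (fun μ => ∑' m : ℕ, besselCliffordCoeff μ m * s ^ m)
      (Metric.ball ν a) := by
    refine Complex.differentiableOn_tsum_of_summable_norm hs (fun m => ?_) Metric.isOpen_ball
      (fun m μ hμ => ?_)
    · refine Differentiable.differentiableOn (Differentiable.mul_const ?_ _)
      have : Differentiable ℂ fun μ : ℂ =>
          (m.factorial : ℂ)⁻¹ * (Complex.Gamma ((m : ℂ) + 1 + μ))⁻¹ :=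
        (Complex.differentiable_one_div_Gamma.comp (differentiable_id.const_add _)).const_mul _
      simpa only [besselCliffordCoeff, mul_inv] using this
    · have hre : a ≤ 1 + μ.re := by
        have h1 := (Complex.abs_re_le_norm (μ - ν)).trans (mem_ball_iff_norm.1 hμ).le
        rw [Complex.sub_re, abs_le] at h1
        linarith
      have h2 := hC μ (Metric.ball_subset_closedBall hμ)
      rw [norm_norm] at h2
      rw [norm_mul, norm_pow, mul_pow]
      calc _ ≤ C * (a⁻¹ ^ m / m.factorial) * ‖s‖ ^ m := by
            gcongr
            exact (norm_besselCliffordCoeff_le ha0 hre m).trans (by gcongr)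
        _ = _ := by ring
  exact hd.differentiableAt (Metric.ball_mem_nhds ν ha0)

/-- The recurrences at `z` and `-z - 1` make the derivative in `s` vanish; the reflection formula
for `Γ` gives the value at `s = 0`. -/
theorem besselClifford_wronskian (z s : ℂ) :
    besselClifford (-z - 1) s * besselClifford z s -
      s * besselClifford (z + 1) s * besselClifford (-z) s = -(Complex.sin (Real.pi * z) / Real.pi) := by
  set D : ℂ → ℂ := fun s => besselClifford (-z - 1) s * besselClifford z s -
      s * besselClifford (z + 1) s * besselClifford (-z) s with hD
  have hd : ∀ s, HasDerivAt D 0 s := by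
    intro s
    have h1 := hasDerivAt_besselClifford (-z - 1) s
    have h2 := hasDerivAt_besselClifford z s
    have h3 := hasDerivAt_besselClifford (z + 1) s
    have h4 := hasDerivAt_besselClifford (-z) s
    have h := (h1.mul h2).sub (((hasDerivAt_id s).mul h3).mul h4)
    refine h.congr_deriv ?_
    have r1 := besselClifford_recurrence z s
    have r2 := besselClifford_recurrence (-z - 1) s
    rw [show -z - 1 + 2 = -z + 1 by ring, show -z - 1 + 1 = -z by ring] at r2
    rw [show -z - 1 + 1 = -z by ring, show z + 1 + 1 = z + 2 by ring]
    simp only [id, Pi.mul_apply]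
    linear_combination (-besselClifford (-z) s) * r1 - besselClifford (z + 1) s * r2
  have hc : D s = D 0 := is_const_of_deriv_eq_zero (fun s => (hd s).differentiableAt)
    (fun s => (hd s).deriv) s 0
  change D s = _
  rw [hc]
  simp only [hD, besselClifford_zero_right, zero_mul, sub_zero]
  have h := Complex.Gamma_mul_Gamma_one_sub (-z)
  rw [show 1 + (-z - 1) = -z by ring, ← mul_inv, show 1 + z = 1 - -z by ring, h, inv_div]
  simp [neg_div]

/-! ### Bessel functions in terms of Bessel-Clifford functions -/

theorem besselJ_eq_besselClifford (ν : ℂ) {ξ : ℂ} (hξ : ξ ≠ 0) :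
    besselJ ν ξ = (ξ / 2) ^ ν * besselClifford ν (-(ξ / 2) ^ 2) := by
  have h0 : ξ / 2 ≠ 0 := div_ne_zero hξ two_ne_zero
  unfold besselJ besselClifford
  rw [← tsum_mul_left]
  refine tsum_congr fun m => ?_
  rw [Complex.cpow_add _ _ h0, neg_pow (_ ^ 2), ← pow_mul, besselCliffordCoeff]
  have : (ξ / 2) ^ (2 * (m : ℂ)) = (ξ / 2) ^ (2 * m) := by
    rw [← Complex.cpow_natCast]
    push_cast
    rfl
  rw [this, div_eq_mul_inv]
  ring

theorem besselI_eq_besselClifford (ν : ℂ) {y : ℝ} (hy : 0 < y) :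
    besselI ν (y : ℂ) = ((y : ℂ) / 2) ^ ν * besselClifford ν (((y : ℂ) / 2) ^ 2) := by
  have hy0 : (y : ℂ) ≠ 0 := by exact_mod_cast hy.ne'
  have hI : Complex.exp (Real.pi * Complex.I / 2) = Complex.I := by
    rw [show (Real.pi : ℂ) * Complex.I / 2 = Real.pi / 2 * Complex.I by ring,
      Complex.exp_pi_div_two_mul_I]
  unfold besselI
  rw [if_pos (by rw [Complex.arg_ofReal_of_nonneg hy.le]; positivity), hI,
    besselJ_eq_besselClifford ν (mul_ne_zero Complex.I_ne_zero hy0)]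
  have h1 : (Complex.I * (y : ℂ) / 2) ^ ν = Complex.exp (Real.pi * ν * Complex.I / 2) *
      ((y : ℂ) / 2) ^ ν := by
    have hy2 : (y : ℂ) / 2 = ((y / 2 : ℝ) : ℂ) := by push_cast; ring
    have hne : (y : ℂ) / 2 ≠ 0 := div_ne_zero hy0 two_ne_zero
    rw [show Complex.I * (y : ℂ) / 2 = (y : ℂ) / 2 * Complex.I by ring,
      Complex.cpow_def_of_ne_zero (mul_ne_zero hne Complex.I_ne_zero),
      Complex.cpow_def_of_ne_zero hne, hy2,
      Complex.log_ofReal_mul (by positivity) Complex.I_ne_zero, Complex.log_I,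
      Complex.ofReal_log (by positivity), ← Complex.exp_add]
    congr 1
    ring
  rw [h1, ← mul_assoc, ← mul_assoc, ← Complex.exp_add, neg_add_cancel, Complex.exp_zero, one_mul]
  congr 2
  rw [mul_div_assoc, mul_pow, Complex.I_sq]
  ring

/-! ### The Macdonald integral in the open right half-plane -/

/-- The integrand of `∫ t ^ (z - 1) exp (- p t - q / t) dt` after the substitution `t = exp u`. -/
noncomputable def macdonaldKernel (z p q : ℂ) (u : ℝ) : ℂ :=
  Complex.exp (z * u - p * Complex.exp u - q * Complex.exp (-u))

/-- The integral `∫ t ^ (z - 1) exp (- p t - q / t) dt` over the positive half-line, written in the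
variable `log t`. -/
noncomputable def macdonaldIntegral (z p q : ℂ) : ℂ := ∫ u : ℝ, macdonaldKernel z p q u

theorem norm_macdonaldKernel (z p q : ℂ) (u : ℝ) :
    ‖macdonaldKernel z p q u‖ =
      Real.exp (z.re * u - p.re * Real.exp u - q.re * Real.exp (-u)) := by
  rw [macdonaldKernel, Complex.norm_exp]
  congr 1
  have h1 : Complex.exp u = ((Real.exp u : ℝ) : ℂ) := (Complex.ofReal_exp u).symm
  have h2 : Complex.exp (-u) = ((Real.exp (-u) : ℝ) : ℂ) := by push_cast; rfl
  rw [h1, h2, Complex.sub_re, Complex.sub_re, Complex.re_mul_ofReal, Complex.re_mul_ofReal,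
    Complex.re_mul_ofReal]

theorem continuous_macdonaldKernel (z p q : ℂ) : Continuous (macdonaldKernel z p q) := by
  unfold macdonaldKernel
  fun_prop

theorem integrable_exp_sub_exp_sub_exp (σ : ℝ) {a b : ℝ} (ha : 0 < a) (hb : 0 < b) :
    Integrable fun u : ℝ => Real.exp (σ * u - a * Real.exp u - b * Real.exp (-u)) := by
  set c : ℝ := min a b / 2 with hc
  have hc0 : 0 < c := by positivity
  have hg : Integrable fun u : ℝ => Real.exp (-c * u ^ 2 + σ * u) := by
    have h := (integrable_cexp_quadratic' (b := ((-c : ℝ) : ℂ)) (by simpa using hc0)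
      (σ : ℂ) 0).norm
    refine h.congr (Eventually.of_forall fun u => ?_)
    simp only
    rw [Complex.norm_exp]
    congr 1
    have : (((-c : ℝ) : ℂ) * (u : ℂ) ^ 2 + (σ : ℂ) * u + 0) = ((-c * u ^ 2 + σ * u : ℝ) : ℂ) := by
      push_cast; ring
    rw [this, Complex.ofReal_re]
  refine hg.mono' (by fun_prop) (Eventually.of_forall fun u => ?_)
  rw [Real.norm_of_nonneg (Real.exp_pos _).le, Real.exp_le_exp]
  have hca : 2 * c ≤ a := by rw [hc]; linarith [min_le_left a b]
  have hcb : 2 * c ≤ b := by rw [hc]; linarith [min_le_right a b]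
  have e1 := Real.exp_pos u
  have e2 := Real.exp_pos (-u)
  -- With `a, b ≥ 2 c` this gives `a exp u + b exp (-u) ≥ c u ^ 2`, hence the Gaussian majorant.
  have key : u ^ 2 / 2 ≤ Real.exp u + Real.exp (-u) := by
    rcases le_total 0 u with hu | hu
    · linarith [Real.quadratic_le_exp_of_nonneg hu]
    · have := Real.quadratic_le_exp_of_nonneg (neg_nonneg.2 hu)
      rw [neg_sq] at this
      linarith
  nlinarith [mul_le_mul_of_nonneg_right hca e1.le, mul_le_mul_of_nonneg_right hcb e2.le,
    mul_le_mul_of_nonneg_left key hc0.le]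

theorem integrable_macdonaldKernel (z : ℂ) {p q : ℂ} (hp : 0 < p.re) (hq : 0 < q.re) :
    Integrable (macdonaldKernel z p q) := by
  refine (integrable_exp_sub_exp_sub_exp z.re hp hq).mono'
    (continuous_macdonaldKernel z p q).aestronglyMeasurable (Eventually.of_forall fun u => ?_)
  rw [norm_macdonaldKernel]

theorem macdonaldKernel_neg (z p q : ℂ) (u : ℝ) :
    macdonaldKernel z p q (-u) = macdonaldKernel (-z) q p u := by
  simp only [macdonaldKernel, Complex.ofReal_neg, neg_neg]
  congr 1
  ring

theorem macdonaldIntegral_swap (z p q : ℂ) :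
    macdonaldIntegral z p q = macdonaldIntegral (-z) q p := by
  simp only [macdonaldIntegral, ← macdonaldKernel_neg z p q]
  exact (integral_neg_eq_self _ volume).symm

theorem macdonaldKernel_add_one (z p q : ℂ) (u : ℝ) :
    macdonaldKernel (z + 1) p q u = Complex.exp u * macdonaldKernel z p q u := by
  rw [macdonaldKernel, macdonaldKernel, ← Complex.exp_add]
  congr 1
  ring

theorem macdonaldKernel_sub_one (z p q : ℂ) (u : ℝ) :
    macdonaldKernel (z - 1) p q u = Complex.exp (-u) * macdonaldKernel z p q u := by
  rw [macdonaldKernel, macdonaldKernel, ← Complex.exp_add]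
  congr 1
  ring

theorem hasDerivAt_macdonaldIntegral (z : ℂ) {p q : ℂ} (hp : 0 < p.re) (hq : 0 < q.re) :
    HasDerivAt (fun p => macdonaldIntegral z p q) (-macdonaldIntegral (z + 1) p q) p := by
  have hball : ∀ w ∈ Metric.ball p (p.re / 2), p.re / 2 < w.re := by
    intro w hw
    have h1 := (Complex.abs_re_le_norm (w - p)).trans_lt (mem_ball_iff_norm.1 hw)
    rw [Complex.sub_re, abs_lt] at h1
    linarith
  have h := (hasDerivAt_integral_of_dominated_loc_of_deriv_le (μ := volume)
    (F := fun p u => macdonaldKernel z p q u) (F' := fun p u => -macdonaldKernel (z + 1) p q u)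
    (x₀ := p) (bound := fun u : ℝ =>
      Real.exp ((z + 1).re * u - (p.re / 2) * Real.exp u - q.re * Real.exp (-u)))
    (Metric.ball_mem_nhds p (half_pos hp))
    (Eventually.of_forall fun w => (continuous_macdonaldKernel z w q).aestronglyMeasurable)
    (integrable_macdonaldKernel z hp hq)
    (continuous_macdonaldKernel (z + 1) p q).neg.aestronglyMeasurable
    (Eventually.of_forall fun u w hw => ?_)
    (integrable_exp_sub_exp_sub_exp _ (half_pos hp) hq)
    (Eventually.of_forall fun u w _ => ?_)).2
  · rw [integral_neg] at h
    exact h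
  · rw [norm_neg, norm_macdonaldKernel, Real.exp_le_exp]
    have := mul_le_mul_of_nonneg_right (hball w hw).le (Real.exp_pos u).le
    linarith
  · have h1 : HasDerivAt (fun w : ℂ => z * u - w * Complex.exp u - q * Complex.exp (-u))
        (-(1 * Complex.exp u)) w :=
      (((hasDerivAt_id w).mul_const (Complex.exp u)).const_sub (z * u)).sub_const _
    refine h1.cexp.congr_deriv ?_
    rw [macdonaldKernel_add_one, macdonaldKernel]
    ring

theorem hasDerivAt_macdonaldKernel (z p q : ℂ) (u : ℝ) : HasDerivAt (macdonaldKernel z p q)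
    (z * macdonaldKernel z p q u - p * macdonaldKernel (z + 1) p q u +
      q * macdonaldKernel (z - 1) p q u) u := by
  have h0 : HasDerivAt (fun u : ℝ => (u : ℂ)) 1 u := Complex.ofRealCLM.hasDerivAt
  have h1 := (((h0.const_mul z).sub (h0.cexp.const_mul p)).sub (h0.neg.cexp.const_mul q)).cexp
  refine h1.congr_deriv ?_
  rw [macdonaldKernel_add_one, macdonaldKernel_sub_one, macdonaldKernel]
  simp only [Pi.sub_apply, Pi.neg_apply]
  ring

/-- The derivative of the kernel in `u` integrates to zero over the line. -/
theorem macdonaldIntegral_recurrence (z : ℂ) {p q : ℂ} (hp : 0 < p.re) (hq : 0 < q.re) :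
    p * macdonaldIntegral (z + 1) p q =
      z * macdonaldIntegral z p q + q * macdonaldIntegral (z - 1) p q := by
  have hI := fun w => integrable_macdonaldKernel w hp hq
  have h := integral_eq_zero_of_hasDerivAt_of_integrable (hasDerivAt_macdonaldKernel z p q)
    ((((hI z).const_mul z).sub ((hI (z + 1)).const_mul p)).add ((hI (z - 1)).const_mul q)) (hI z)
  rw [integral_add, integral_sub ((hI z).const_mul z) ((hI (z + 1)).const_mul p),
    integral_const_mul, integral_const_mul, integral_const_mul] at h
  rotate_left
  · exact ((hI z).const_mul z).sub ((hI (z + 1)).const_mul p)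
  · exact (hI (z - 1)).const_mul q
  simp only [macdonaldIntegral]
  linear_combination -h

/-- Translation of `u` by `log r`. -/
theorem macdonaldIntegral_ofReal_scale (z p q : ℂ) {r : ℝ} (hr : 0 < r) :
    macdonaldIntegral z (p * r) q = (r : ℂ) ^ (-z) * macdonaldIntegral z p (q * r) := by
  have h := integral_add_right_eq_self (μ := volume) (fun u => macdonaldKernel z p (q * r) u)
    (Real.log r)
  rw [macdonaldIntegral, macdonaldIntegral, ← h, ← integral_const_mul]
  refine integral_congr_ae (Eventually.of_forall fun u => ?_)
  have hr0 : (r : ℂ) ≠ 0 := by exact_mod_cast hr.ne'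
  simp only [macdonaldKernel]
  rw [Complex.cpow_def_of_ne_zero hr0, ← Complex.exp_add]
  have h1 : Complex.exp (Real.log r : ℂ) = r := by
    rw [← Complex.ofReal_exp, Real.exp_log hr]
  have h2 : Complex.exp ((u + Real.log r : ℝ) : ℂ) = Complex.exp u * r := by
    rw [Complex.ofReal_add, Complex.exp_add, h1]
  have h3 : Complex.exp (-((u + Real.log r : ℝ) : ℂ)) = Complex.exp (-u) * (r : ℂ)⁻¹ := by
    rw [Complex.ofReal_add, neg_add, Complex.exp_add, Complex.exp_neg (Real.log r : ℂ), h1]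
  rw [h2, h3, Complex.ofReal_add, Complex.ofReal_log hr.le]
  congr 1
  field_simp
  ring

/-! ### Behaviour of the Macdonald integral at the origin -/

theorem integrable_exp_sub_exp_and_integral_eq_Gamma {s : ℂ} (hs : 0 < s.re) :
    Integrable (fun u : ℝ => Complex.exp (s * u - Complex.exp u)) ∧
      ∫ u : ℝ, Complex.exp (s * u - Complex.exp u) = Complex.Gamma s := by
  have hd : ∀ u ∈ (Set.univ : Set ℝ), HasDerivWithinAt Real.exp (Real.exp u) Set.univ u :=
    fun u _ => (Real.hasDerivAt_exp u).hasDerivWithinAt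
  have hi : Set.InjOn Real.exp Set.univ := Real.exp_injective.injOn
  have him : Real.exp '' Set.univ = Set.Ioi 0 := by rw [Set.image_univ, Real.range_exp]
  have he : ∀ u : ℝ, |Real.exp u| • (((-Real.exp u).exp : ℂ) * (Real.exp u : ℂ) ^ (s - 1)) =
      Complex.exp (s * u - Complex.exp u) := by
    intro u
    rw [abs_of_pos (Real.exp_pos u), Complex.real_smul, Complex.cpow_def_of_ne_zero
      (by exact_mod_cast (Real.exp_pos u).ne'), ← Complex.ofReal_log (Real.exp_pos u).le,
      Real.log_exp]
    push_cast
    rw [← Complex.exp_add, ← Complex.exp_add]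
    congr 1
    ring
  have h1 := Complex.GammaIntegral_convergent hs
  rw [← him, integrableOn_image_iff_integrableOn_abs_deriv_smul MeasurableSet.univ hd hi,
    integrableOn_univ] at h1
  constructor
  · exact h1.congr (Eventually.of_forall he)
  · rw [Complex.Gamma_eq_integral hs, Complex.GammaIntegral, ← him,
      integral_image_eq_integral_abs_deriv_smul MeasurableSet.univ hd hi, setIntegral_univ]
    exact integral_congr_ae (Eventually.of_forall fun u => (he u).symm)

theorem integrable_exp_sub_exp {σ : ℝ} (hσ : 0 < σ) :
    Integrable fun u : ℝ => Real.exp (σ * u - Real.exp u) := by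
  refine (integrable_exp_sub_exp_and_integral_eq_Gamma (s := σ) (by simpa)).1.norm.congr
    (Eventually.of_forall fun u => ?_)
  simp only
  rw [Complex.norm_exp]
  norm_cast

theorem tendsto_macdonaldIntegral_one {s : ℂ} (hs : 0 < s.re) :
    Tendsto (fun p : ℝ => macdonaldIntegral s 1 p) (𝓝[>] 0) (𝓝 (Complex.Gamma s)) := by
  rw [← (integrable_exp_sub_exp_and_integral_eq_Gamma hs).2]
  refine tendsto_integral_filter_of_dominated_convergence
    (fun u => Real.exp (s.re * u - Real.exp u))
    (Eventually.of_forall fun p => (continuous_macdonaldKernel s 1 p).aestronglyMeasurable) ?_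
    (integrable_exp_sub_exp hs) (Eventually.of_forall fun u => ?_)
  · filter_upwards [self_mem_nhdsWithin] with p hp
    refine Eventually.of_forall fun u => ?_
    rw [norm_macdonaldKernel, Real.exp_le_exp]
    have := mul_nonneg (le_of_lt hp) (Real.exp_pos (-u)).le
    simp only [Complex.one_re, one_mul, Complex.ofReal_re]
    linarith
  · have hc : Continuous fun p : ℝ => macdonaldKernel s 1 p u := by
      unfold macdonaldKernel
      fun_prop
    have := (hc.tendsto 0).mono_left (nhdsWithin_le_nhds (s := Set.Ioi 0))
    simpa [macdonaldKernel] using this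

theorem tendsto_mul_macdonaldIntegral_one {z : ℂ} (hz : -1 < z.re) :
    Tendsto (fun p : ℝ => (p : ℂ) * macdonaldIntegral z 1 p) (𝓝[>] 0) (𝓝 0) := by
  simp only [macdonaldIntegral, ← integral_const_mul]
  rw [← integral_zero ℝ ℂ (μ := volume)]
  refine tendsto_integral_filter_of_dominated_convergence
    (fun u => Real.exp ((z.re + 1) * u - Real.exp u))
    (Eventually.of_forall fun p =>
      ((continuous_macdonaldKernel z 1 p).const_mul _).aestronglyMeasurable) ?_
    (integrable_exp_sub_exp (by linarith)) (Eventually.of_forall fun u => ?_)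
  · filter_upwards [self_mem_nhdsWithin] with p hp
    refine Eventually.of_forall fun u => ?_
    have hp' : (0 : ℝ) < p := hp
    rw [norm_mul, norm_macdonaldKernel, Complex.norm_of_nonneg hp'.le]
    -- The inequality `y ≤ exp y` trades the factor `p` for `exp u`, which raises the exponent `re
    -- z` to `re z + 1 > 0`; the factor `exp (p exp (-u))` cancels against the kernel.
    have h1 : p * Real.exp (-u) ≤ Real.exp (p * Real.exp (-u)) := by
      linarith [Real.add_one_le_exp (p * Real.exp (-u))]
    have h2 : p ≤ Real.exp (u + p * Real.exp (-u)) := by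
      rw [Real.exp_add]
      calc p = Real.exp u * (p * Real.exp (-u)) := by
            rw [mul_left_comm, ← Real.exp_add]; simp
        _ ≤ _ := by gcongr
    calc _ ≤ Real.exp (u + p * Real.exp (-u)) *
          Real.exp (z.re * u - (1 : ℂ).re * Real.exp u - (p : ℂ).re * Real.exp (-u)) := by gcongr
      _ = _ := by
        rw [← Real.exp_add]
        congr 1
        simp only [Complex.one_re, Complex.ofReal_re]
        ring
  · have hc : Continuous fun p : ℝ => (p : ℂ) * macdonaldKernel z 1 p u := by
      unfold macdonaldKernel
      fun_prop
    have := (hc.tendsto 0).mono_left (nhdsWithin_le_nhds (s := Set.Ioi 0))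
    simpa using this

/-! ### Evaluation by Wronskians and analytic continuation -/

theorem isOpen_re_pos : IsOpen {s : ℂ | 0 < s.re} :=
  isOpen_lt continuous_const Complex.continuous_re

theorem isPreconnected_re_pos : IsPreconnected {s : ℂ | 0 < s.re} :=
  (convex_halfSpace_re_gt 0).isPreconnected

theorem hasDerivAt_macdonaldIntegral_right (z : ℂ) {p q : ℂ} (hp : 0 < p.re) (hq : 0 < q.re) :
    HasDerivAt (fun q => macdonaldIntegral z p q) (-macdonaldIntegral (z - 1) p q) q := by
  have h := hasDerivAt_macdonaldIntegral (-z) hq hp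
  rw [macdonaldIntegral_swap (-z + 1), show -(-z + 1) = z - 1 by ring] at h
  simpa only [macdonaldIntegral_swap (-z), neg_neg] using h

/-- The two recurrences make the left side constant in `p`. As `p → 0+` the first term vanishes and
the second tends to `Γ(z + 1) / Γ(1 + z)`. -/
theorem macdonaldIntegral_wronskian {z : ℂ} (hz : -1 < z.re) {p : ℂ} (hp : 0 < p.re) :
    p * macdonaldIntegral z 1 p * besselClifford (z + 1) p +
      macdonaldIntegral (z + 1) 1 p * besselClifford z p = 1 := by
  set V : ℂ → ℂ := fun p => p * macdonaldIntegral z 1 p * besselClifford (z + 1) p +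
      macdonaldIntegral (z + 1) 1 p * besselClifford z p with hV
  have h1re : 0 < (1 : ℂ).re := by simp
  have hd : ∀ p : ℂ, 0 < p.re → HasDerivAt V 0 p := by
    intro p hp
    have h1 := hasDerivAt_macdonaldIntegral_right z h1re hp
    have h2 := hasDerivAt_macdonaldIntegral_right (z + 1) h1re hp
    have h := (((hasDerivAt_id p).mul h1).mul (hasDerivAt_besselClifford (z + 1) p)).add
      (h2.mul (hasDerivAt_besselClifford z p))
    refine h.congr_deriv ?_
    have r1 := besselClifford_recurrence z p
    have r2 := macdonaldIntegral_recurrence z h1re hp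
    rw [show z + 1 + 1 = z + 2 by ring, show z + 1 - 1 = z by ring]
    simp only [id, Pi.mul_apply]
    linear_combination macdonaldIntegral z 1 p * r1 + besselClifford (z + 1) p * r2
  have hc : ∀ r : ℝ, 0 < r → V r = V p := fun r hr =>
    isOpen_re_pos.is_const_of_deriv_eq_zero isPreconnected_re_pos
      (fun s hs => (hd s hs).differentiableAt.differentiableWithinAt)
      (fun s hs => (hd s hs).deriv) (by simpa using hr) hp
  have hB : ∀ ν, Tendsto (fun r : ℝ => besselClifford ν r) (𝓝[>] 0)
      (𝓝 (Complex.Gamma (1 + ν))⁻¹) := by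
    intro ν
    have h := (((differentiable_besselClifford ν).continuous.comp
      Complex.continuous_ofReal).tendsto 0).mono_left (nhdsWithin_le_nhds (s := Set.Ioi (0 : ℝ)))
    simpa [besselClifford_zero_right, Function.comp_def] using h
  have hz1 : 0 < (z + 1).re := by simp; linarith
  have hlim : Tendsto (fun r : ℝ => V r) (𝓝[>] 0) (𝓝 1) := by
    have h := ((tendsto_mul_macdonaldIntegral_one hz).mul (hB (z + 1))).add
      ((tendsto_macdonaldIntegral_one hz1).mul (hB z))
    rw [add_comm 1 z, mul_inv_cancel₀ (Complex.Gamma_ne_zero_of_re_pos hz1), zero_mul,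
      zero_add] at h
    exact h
  refine tendsto_nhds_unique (tendsto_const_nhds.congr' ?_) hlim
  filter_upwards [self_mem_nhdsWithin] with r hr
  exact (hc r hr).symm

theorem sin_pi_mul_ne_zero_of_re {z : ℂ} (h1 : -1 < z.re) (h2 : z.re < 1) (hz : z ≠ 0) :
    Complex.sin (Real.pi * z) ≠ 0 := by
  have hpi : (Real.pi : ℂ) ≠ 0 := by exact_mod_cast Real.pi_ne_zero
  intro h
  obtain ⟨k, hk⟩ := Complex.sin_eq_zero_iff.1 h
  have hk' : z = k := by
    rw [mul_comm] at hk
    exact mul_right_cancel₀ hpi hk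
  rw [hk', Complex.intCast_re] at h1 h2
  have h3 : (-1 : ℤ) < k := by exact_mod_cast h1
  have h4 : k < (1 : ℤ) := by exact_mod_cast h2
  have h5 : k = 0 := by omega
  exact hz (by rw [hk', h5, Int.cast_zero])

theorem macdonaldIntegral_neg_one_ofReal (z : ℂ) {r : ℝ} (hr : 0 < r) :
    macdonaldIntegral (-z) 1 r = (r : ℂ) ^ (-z) * macdonaldIntegral z 1 r := by
  have h := macdonaldIntegral_ofReal_scale z 1 1 hr
  rw [one_mul] at h
  rw [macdonaldIntegral_swap (-z), neg_neg, h]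

/-- The symmetry `z ↦ -z` and the recurrence turn the Wronskian relations for `z` and `-z` into two
linear equations for the integrals of orders `z` and `z - 1`. The determinant is
`besselClifford_wronskian` up to a nonzero factor, and `sin (π z) ≠ 0`. -/
theorem macdonaldIntegral_one_ofReal {z : ℂ} (h1 : -1 < z.re) (h2 : z.re < 1) (hz : z ≠ 0)
    {r : ℝ} (hr : 0 < r) :
    macdonaldIntegral z 1 r = Real.pi / Complex.sin (Real.pi * z) *
      (besselClifford (-z) r - (r : ℂ) ^ z * besselClifford z r) := by
  have hr0 : (r : ℂ) ≠ 0 := by exact_mod_cast hr.ne'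
  have hrre : 0 < (r : ℂ).re := by simpa using hr
  have hpi : (Real.pi : ℂ) ≠ 0 := by exact_mod_cast Real.pi_ne_zero
  have hs := sin_pi_mul_ne_zero_of_re h1 h2 hz
  have w1 := macdonaldIntegral_wronskian h1 hrre
  have w2 := macdonaldIntegral_wronskian (z := -z) (by simpa using h2) hrre
  have e2 := macdonaldIntegral_neg_one_ofReal (z - 1) hr
  rw [show -(z - 1) = -z + 1 by ring] at e2
  rw [macdonaldIntegral_neg_one_ofReal z hr, e2, Complex.cpow_add _ _ hr0, Complex.cpow_neg,
    Complex.cpow_one] at w2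
  have hX : (r : ℂ) ^ z ≠ 0 := by
    rw [Complex.cpow_def_of_ne_zero hr0]; exact Complex.exp_ne_zero _
  have r1 := macdonaldIntegral_recurrence z (p := 1) (by simp) hrre
  have r2 := besselClifford_recurrence (-z - 1) r
  rw [show -z - 1 + 2 = -z + 1 by ring, show -z - 1 + 1 = -z by ring] at r2
  have w3 : (r : ℂ) * macdonaldIntegral z 1 r * besselClifford (-z + 1) r +
      r * macdonaldIntegral (z - 1) 1 r * besselClifford (-z) r = (r : ℂ) ^ z := by
    field_simp at w2
    linear_combination w2
  have w4 := besselClifford_wronskian z r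
  have hfin : macdonaldIntegral z 1 r * -(Complex.sin (Real.pi * z) / Real.pi) =
      (r : ℂ) ^ z * besselClifford z r - besselClifford (-z) r := by
    rw [← w4]
    linear_combination besselClifford z r * w3 - besselClifford (-z) r * w1
      - macdonaldIntegral z 1 r * besselClifford z r * r2
      + besselClifford (-z) r * besselClifford z r * r1
  field_simp
  field_simp at hfin
  linear_combination -hfin

/-- The value of `macdonaldIntegral z p q` at a non-integral order. -/
noncomputable def macdonaldSeries (z p q : ℂ) : ℂ :=
  Real.pi / Complex.sin (Real.pi * z) *
    (p ^ (-z) * besselClifford (-z) (p * q) - q ^ z * besselClifford z (p * q))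

theorem macdonaldSeries_swap (z p q : ℂ) : macdonaldSeries z p q = macdonaldSeries (-z) q p := by
  simp only [macdonaldSeries, neg_neg, mul_neg, Complex.sin_neg, mul_comm q p, div_neg]
  ring

theorem macdonaldIntegral_ofReal {z : ℂ} (h1 : -1 < z.re) (h2 : z.re < 1) (hz : z ≠ 0)
    {p q : ℝ} (hp : 0 < p) (hq : 0 < q) :
    macdonaldIntegral z p q = macdonaldSeries z p q := by
  have hp0 : (p : ℂ) ≠ 0 := by exact_mod_cast hp.ne'
  have h := macdonaldIntegral_ofReal_scale z 1 q hp
  have hX : (p : ℂ) ^ z ≠ 0 := by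
    rw [Complex.cpow_def_of_ne_zero hp0]; exact Complex.exp_ne_zero _
  rw [one_mul, ← Complex.ofReal_mul, macdonaldIntegral_one_ofReal h1 h2 hz (mul_pos hq hp),
    Complex.ofReal_mul, Complex.mul_cpow_ofReal_nonneg hq.le hp.le] at h
  rw [h, macdonaldSeries, Complex.cpow_neg, mul_comm (q : ℂ) p]
  field_simp

theorem differentiableOn_macdonaldSeries (z q : ℂ) :
    DifferentiableOn ℂ (fun p => macdonaldSeries z p q) {p | 0 < p.re} := by
  intro p hp
  have hs : p ∈ Complex.slitPlane := Or.inl hp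
  have hB : ∀ ν, DifferentiableAt ℂ (fun p => besselClifford ν (p * q)) p := fun ν =>
    ((differentiable_besselClifford ν).comp (differentiable_id.mul_const q)) p
  exact (((((differentiableAt_id.cpow_const hs).mul (hB (-z))).sub
    ((hB z).const_mul _))).const_mul _).differentiableWithinAt

theorem eqOn_macdonaldSeries {z q : ℂ} (hq : 0 < q.re)
    (h : ∀ r : ℝ, 0 < r → macdonaldIntegral z r q = macdonaldSeries z r q) {p : ℂ}
    (hp : 0 < p.re) : macdonaldIntegral z p q = macdonaldSeries z p q := by
  have hf : AnalyticOnNhd ℂ (fun p => macdonaldIntegral z p q) {p | 0 < p.re} :=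
    DifferentiableOn.analyticOnNhd (fun p hp =>
      (hasDerivAt_macdonaldIntegral z hp hq).differentiableAt.differentiableWithinAt) isOpen_re_pos
  have hg := (differentiableOn_macdonaldSeries z q).analyticOnNhd isOpen_re_pos
  refine hf.eqOn_of_preconnected_of_frequently_eq hg isPreconnected_re_pos (z₀ := 1) (by simp)
    ?_ hp
  have ht : Tendsto (fun r : ℝ => (r : ℂ)) (𝓝[≠] 1) (𝓝[≠] 1) := by
    refine tendsto_nhdsWithin_iff.2 ⟨?_, ?_⟩
    · have := (Complex.continuous_ofReal.tendsto 1).mono_left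
        (nhdsWithin_le_nhds (s := {(1 : ℝ)}ᶜ))
      simpa using this
    · filter_upwards [self_mem_nhdsWithin] with r hr
      simpa using hr
  refine ht.frequently (Eventually.frequently ?_)
  filter_upwards [nhdsWithin_le_nhds (lt_mem_nhds (zero_lt_one (α := ℝ)))] with r hr
  exact h r hr

/-- The swap symmetry exchanges `p` and `q`, so continuation in the first variable serves for both.
-/
theorem macdonaldIntegral_eq_macdonaldSeries {z : ℂ} (h1 : -1 < z.re) (h2 : z.re < 1)
    (hz : z ≠ 0) {p q : ℂ} (hp : 0 < p.re) (hq : 0 < q.re) :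
    macdonaldIntegral z p q = macdonaldSeries z p q := by
  refine eqOn_macdonaldSeries hq (fun r hr => ?_) hp
  rw [macdonaldIntegral_swap, macdonaldSeries_swap]
  refine eqOn_macdonaldSeries (by simpa using hr) (fun t ht => ?_) hq
  exact macdonaldIntegral_ofReal (by simpa using h2) (by simp; linarith) (neg_ne_zero.2 hz) ht hr

/-! ### Conditional convergence and passage to the imaginary axis -/

/-- The improper integral of `macdonaldKernel z p q` over the positive half-line, integrated by
parts so that it converges absolutely for `0 ≤ re p`, `p ≠ 0`, `0 ≤ re q` and `re z < 1`. -/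
noncomputable def macdonaldTail (z p q : ℂ) : ℂ :=
  (macdonaldKernel (z - 1) p q 0 +
    ∫ u : ℝ in Set.Ioi 0, (z - 1 + q * Complex.exp (-u)) * macdonaldKernel (z - 1) p q u) / p

theorem norm_macdonaldKernel_le (z : ℂ) {p q : ℂ} (hp : 0 ≤ p.re) (hq : 0 ≤ q.re) (u : ℝ) :
    ‖macdonaldKernel z p q u‖ ≤ Real.exp (z.re * u) := by
  rw [norm_macdonaldKernel, Real.exp_le_exp]
  have h1 := mul_nonneg hp (Real.exp_pos u).le
  have h2 := mul_nonneg hq (Real.exp_pos (-u)).le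
  linarith

theorem norm_macdonaldTail_integrand_le (z : ℂ) {p q : ℂ} (hp : 0 ≤ p.re) (hq : 0 ≤ q.re)
    {u : ℝ} (hu : 0 < u) :
    ‖(z - 1 + q * Complex.exp (-u)) * macdonaldKernel (z - 1) p q u‖ ≤
      (‖z - 1‖ + ‖q‖) * Real.exp ((z.re - 1) * u) := by
  rw [norm_mul]
  have h1 := norm_macdonaldKernel_le (z - 1) hp hq u
  rw [Complex.sub_re, Complex.one_re] at h1
  have h2 : ‖Complex.exp (-u)‖ ≤ 1 := by
    rw [Complex.norm_exp]
    simpa using hu.le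
  refine mul_le_mul ((norm_add_le _ _).trans ?_) h1 (norm_nonneg _) (by positivity)
  rw [norm_mul]
  gcongr
  exact mul_le_of_le_one_right (norm_nonneg _) h2

theorem continuous_macdonaldTail_integrand (z p q : ℂ) : Continuous fun u : ℝ =>
    (z - 1 + q * Complex.exp (-u)) * macdonaldKernel (z - 1) p q u := by
  unfold macdonaldKernel
  fun_prop

theorem tendsto_integral_macdonaldKernel_Ioi {z p q : ℂ} (hz : z.re < 1) (hp : 0 ≤ p.re)
    (hp0 : p ≠ 0) (hq : 0 ≤ q.re) :
    Tendsto (fun L : ℝ => ∫ u in (0 : ℝ)..L, macdonaldKernel z p q u) atTop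
      (𝓝 (macdonaldTail z p q)) := by
  have hint : IntegrableOn (fun u : ℝ =>
      (z - 1 + q * Complex.exp (-u)) * macdonaldKernel (z - 1) p q u) (Set.Ioi 0) := by
    refine ((integrableOn_exp_mul_Ioi (a := z.re - 1) (by linarith) 0).const_mul
      (‖z - 1‖ + ‖q‖)).mono' (continuous_macdonaldTail_integrand z p q).aestronglyMeasurable ?_
    filter_upwards [ae_restrict_mem measurableSet_Ioi] with u hu
    exact norm_macdonaldTail_integrand_le z hp hq hu
  have hlim := intervalIntegral_tendsto_integral_Ioi (0 : ℝ) hint tendsto_id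
  have hb : Tendsto (fun L : ℝ => macdonaldKernel (z - 1) p q L) atTop (𝓝 0) := by
    refine squeeze_zero_norm (fun L => norm_macdonaldKernel_le (z - 1) hp hq L) ?_
    refine Real.tendsto_exp_atBot.comp (tendsto_id.const_mul_atTop_of_neg ?_)
    simpa using hz
  have h := ((hlim.add_const (macdonaldKernel (z - 1) p q 0)).sub hb).div_const p
  rw [sub_zero, add_comm] at h
  refine h.congr fun L => ?_
  have hd : ∀ u ∈ Set.uIcc 0 L, HasDerivAt (macdonaldKernel (z - 1) p q)
      ((z - 1 + q * Complex.exp (-u)) * macdonaldKernel (z - 1) p q u -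
        p * macdonaldKernel z p q u) u := by
    intro u _
    refine (hasDerivAt_macdonaldKernel (z - 1) p q u).congr_deriv ?_
    rw [macdonaldKernel_sub_one (z - 1), sub_add_cancel]
    ring
  have hi1 := (continuous_macdonaldTail_integrand z p q).intervalIntegrable (μ := volume) 0 L
  have hi2 := ((continuous_macdonaldKernel z p q).const_mul p).intervalIntegrable
    (μ := volume) 0 L
  have hF := intervalIntegral.integral_eq_sub_of_hasDerivAt hd (hi1.sub hi2)
  rw [intervalIntegral.integral_sub hi1 hi2, intervalIntegral.integral_const_mul] at hF
  rw [div_eq_iff hp0]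
  simp only [id]
  linear_combination hF

/-- The line is cut at `0`; reflecting the left half replaces `(z, p, q)` by `(-z, q, p)`, so each
end needs one of the two bounds on `re z`. -/
theorem tendsto_integral_macdonaldKernel {z p q : ℂ} (h1 : -1 < z.re) (h2 : z.re < 1)
    (hp : 0 ≤ p.re) (hp0 : p ≠ 0) (hq : 0 ≤ q.re) (hq0 : q ≠ 0) :
    Tendsto (fun w : ℝ × ℝ => ∫ u in w.1..w.2, macdonaldKernel z p q u) (atBot ×ˢ atTop)
      (𝓝 (macdonaldTail z p q + macdonaldTail (-z) q p)) := by
  have t1 := (tendsto_integral_macdonaldKernel_Ioi h2 hp hp0 hq).comp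
    (tendsto_snd (f := (atBot : Filter ℝ)) (g := (atTop : Filter ℝ)))
  have t2 := (tendsto_integral_macdonaldKernel_Ioi (z := -z) (by simp; linarith) hq hq0 hp).comp
    (tendsto_neg_atBot_atTop.comp
      (tendsto_fst (f := (atBot : Filter ℝ)) (g := (atTop : Filter ℝ))))
  refine (t1.add t2).congr fun w => ?_
  simp only [Function.comp_apply]
  have hc := continuous_macdonaldKernel z p q
  rw [← intervalIntegral.integral_add_adjacent_intervals (hc.intervalIntegrable w.1 0)
    (hc.intervalIntegrable 0 w.2), add_comm]
  congr 1
  simp only [← macdonaldKernel_neg z p q]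
  rw [intervalIntegral.integral_comp_neg, neg_neg, neg_zero]

theorem macdonaldIntegral_eq_tail_add_tail {z p q : ℂ} (h1 : -1 < z.re) (h2 : z.re < 1)
    (hp : 0 < p.re) (hq : 0 < q.re) :
    macdonaldIntegral z p q = macdonaldTail z p q + macdonaldTail (-z) q p := by
  have hp0 : p ≠ 0 := by rintro rfl; simp at hp
  have hq0 : q ≠ 0 := by rintro rfl; simp at hq
  exact tendsto_nhds_unique
    (intervalIntegral_tendsto_integral (integrable_macdonaldKernel z hp hq) tendsto_fst
      tendsto_snd)
    (tendsto_integral_macdonaldKernel h1 h2 hp.le hp0 hq.le hq0)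

theorem continuousWithinAt_macdonaldTail {w₀ : ℂ × ℂ × ℂ} (hz : w₀.1.re < 1) (hp : w₀.2.1 ≠ 0) :
    ContinuousWithinAt (fun w : ℂ × ℂ × ℂ => macdonaldTail w.1 w.2.1 w.2.2)
      {w | 0 ≤ w.2.1.re ∧ 0 ≤ w.2.2.re} w₀ := by
  -- Midway between `re z` at the base point and `1`: nearby integrands share an integrable bound
  -- with exponent `σ - 1 < 0`.
  set σ : ℝ := (w₀.1.re + 1) / 2 with hσ
  have hker : ∀ u : ℝ, Continuous fun w : ℂ × ℂ × ℂ => macdonaldKernel (w.1 - 1) w.2.1 w.2.2 u := by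
    intro u
    unfold macdonaldKernel
    fun_prop
  refine ContinuousWithinAt.div ((hker 0).continuousWithinAt.add ?_)
    (by fun_prop) hp
  have e1 : ∀ᶠ w : ℂ × ℂ × ℂ in 𝓝[{w | 0 ≤ w.2.1.re ∧ 0 ≤ w.2.2.re}] w₀, w.1.re < σ :=
    nhdsWithin_le_nhds (((Complex.continuous_re.comp continuous_fst).tendsto w₀).eventually
      (gt_mem_nhds (by simp only [Function.comp_apply]; linarith)))
  have e2 : ∀ᶠ w : ℂ × ℂ × ℂ in 𝓝[{w | 0 ≤ w.2.1.re ∧ 0 ≤ w.2.2.re}] w₀,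
      ‖w.1 - 1‖ + ‖w.2.2‖ < ‖w₀.1 - 1‖ + ‖w₀.2.2‖ + 1 := by
    have hc : Continuous fun w : ℂ × ℂ × ℂ => ‖w.1 - 1‖ + ‖w.2.2‖ := by fun_prop
    exact nhdsWithin_le_nhds ((hc.tendsto w₀).eventually (gt_mem_nhds (lt_add_one _)))
  refine continuousWithinAt_of_dominated
    (bound := fun u => (‖w₀.1 - 1‖ + ‖w₀.2.2‖ + 1) * Real.exp ((σ - 1) * u))
    (Eventually.of_forall fun w =>
      (continuous_macdonaldTail_integrand w.1 w.2.1 w.2.2).aestronglyMeasurable) ?_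
    ((integrableOn_exp_mul_Ioi (a := σ - 1) (by linarith) 0).const_mul _)
    (Eventually.of_forall fun u =>
      (Continuous.mul (by fun_prop) (hker u)).continuousWithinAt)
  filter_upwards [e1, e2, self_mem_nhdsWithin] with w hw1 hw2 hw3
  filter_upwards [ae_restrict_mem measurableSet_Ioi] with u hu
  refine (norm_macdonaldTail_integrand_le w.1 hw3.1 hw3.2 hu).trans ?_
  have hu' : (0 : ℝ) < u := hu
  gcongr

/-- Shifting `p` and `q` by `δ > 0` enters the open half-plane, and both sides are continuous as `δ
→ 0+`: the closed half-plane without `0` avoids the cut of the power. -/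
theorem macdonaldTail_add_tail_eq_series {z p q : ℂ} (h1 : -1 < z.re) (h2 : z.re < 1)
    (hz : z ≠ 0) (hp : 0 ≤ p.re) (hp0 : p ≠ 0) (hq : 0 ≤ q.re) (hq0 : q ≠ 0) :
    macdonaldTail z p q + macdonaldTail (-z) q p = macdonaldSeries z p q := by
  have hslit : ∀ w : ℂ, 0 ≤ w.re → w ≠ 0 → w ∈ Complex.slitPlane := by
    intro w hw hw0
    rcases hw.lt_or_eq with h | h
    · exact Or.inl h
    · exact Or.inr fun h' => hw0 (Complex.ext h.symm h')
  have hsh : ∀ w : ℂ, Tendsto (fun δ : ℝ => w + δ) (𝓝[>] 0) (𝓝 w) := by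
    intro w
    have hc : Continuous fun δ : ℝ => w + (δ : ℂ) := by fun_prop
    have := (hc.tendsto 0).mono_left (nhdsWithin_le_nhds (s := Set.Ioi (0 : ℝ)))
    simpa using this
  have hre : ∀ w : ℂ, 0 ≤ w.re → ∀ δ : ℝ, 0 < δ → 0 < (w + δ).re := by
    intro w hw δ hδ
    simp only [Complex.add_re, Complex.ofReal_re]
    linarith
  have hT : ∀ z p q : ℂ, z.re < 1 → 0 ≤ p.re → p ≠ 0 → 0 ≤ q.re →
      Tendsto (fun δ : ℝ => macdonaldTail z (p + δ) (q + δ)) (𝓝[>] 0)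
        (𝓝 (macdonaldTail z p q)) := by
    intro z p q hz hp hp0 hq
    refine (continuousWithinAt_macdonaldTail (w₀ := (z, p, q)) hz hp0).tendsto.comp
      (f := fun δ : ℝ => (z, p + (δ : ℂ), q + (δ : ℂ))) (tendsto_nhdsWithin_iff.2 ⟨?_, ?_⟩)
    · exact tendsto_const_nhds.prodMk_nhds ((hsh p).prodMk_nhds (hsh q))
    · filter_upwards [self_mem_nhdsWithin] with δ hδ
      exact ⟨(hre p hp δ hδ).le, (hre q hq δ hδ).le⟩
  have hB : ∀ ν, Tendsto (fun δ : ℝ => besselClifford ν ((p + δ) * (q + δ))) (𝓝[>] 0)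
      (𝓝 (besselClifford ν (p * q))) := fun ν =>
    ((differentiable_besselClifford ν).continuous.tendsto _).comp ((hsh p).mul (hsh q))
  have hP : ∀ w ν : ℂ, 0 ≤ w.re → w ≠ 0 →
      Tendsto (fun δ : ℝ => (w + (δ : ℂ)) ^ ν) (𝓝[>] 0) (𝓝 (w ^ ν)) := fun w ν hw hw0 =>
    (hsh w).cpow tendsto_const_nhds (hslit w hw hw0)
  have hS : Tendsto (fun δ : ℝ => macdonaldSeries z (p + δ) (q + δ)) (𝓝[>] 0)
      (𝓝 (macdonaldSeries z p q)) :=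
    (((hP p (-z) hp hp0).mul (hB (-z))).sub ((hP q z hq hq0).mul (hB z))).const_mul _
  refine tendsto_nhds_unique (((hT z p q h2 hp hp0 hq).add
    (hT (-z) q p (by simp; linarith) hq hq0 hp)).congr' ?_) hS
  filter_upwards [self_mem_nhdsWithin] with δ hδ
  rw [← macdonaldIntegral_eq_tail_add_tail h1 h2 (hre p hp δ hδ) (hre q hq δ hδ),
    macdonaldIntegral_eq_macdonaldSeries h1 h2 hz (hre p hp δ hδ) (hre q hq δ hδ)]

/-- The value of the improper integral of `macdonaldKernel z p q` over the real line. -/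
noncomputable def macdonaldImproper (z p q : ℂ) : ℂ := macdonaldTail z p q + macdonaldTail (-z) q p

theorem tendsto_macdonaldImproper_zero {p q : ℂ} (hp : 0 ≤ p.re) (hp0 : p ≠ 0) (hq : 0 ≤ q.re)
    (hq0 : q ≠ 0) :
    Tendsto (fun z => macdonaldImproper z p q) (𝓝[≠] 0) (𝓝 (macdonaldImproper 0 p q)) := by
  have h : ∀ p q : ℂ, 0 ≤ p.re → p ≠ 0 → 0 ≤ q.re →
      Tendsto (fun z => macdonaldTail z p q) (𝓝 0) (𝓝 (macdonaldTail 0 p q)) := by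
    intro p q hp hp0 hq
    refine (continuousWithinAt_macdonaldTail (w₀ := (0, p, q)) (by simp) hp0).tendsto.comp
      (f := fun z : ℂ => (z, p, q)) (tendsto_nhdsWithin_iff.2 ⟨?_, ?_⟩)
    · exact tendsto_id.prodMk_nhds tendsto_const_nhds
    · exact Eventually.of_forall fun z => ⟨hp, hq⟩
  have hn : Tendsto (fun z : ℂ => -z) (𝓝 0) (𝓝 0) := by
    simpa using (continuous_neg.tendsto (0 : ℂ))
  have h2 := (h p q hp hp0 hq).add ((h q p hq hq0 hp).comp hn)
  simp only [macdonaldImproper, neg_zero]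
  exact h2.mono_left nhdsWithin_le_nhds

/-! ### The Hardy-Koshliakov integral as four Macdonald integrals -/

/-- The integrand `t ^ z cos (x t) cos (1 / t)` at `t = exp u`, as a sum of exponentials. -/
noncomputable def hardyKoshliakovKernel (z : ℂ) (x u : ℝ) : ℂ :=
  (macdonaldKernel z (x * Complex.I) Complex.I u + macdonaldKernel z (x * Complex.I) (-Complex.I) u +
    macdonaldKernel z (-(x * Complex.I)) Complex.I u +
      macdonaldKernel z (-(x * Complex.I)) (-Complex.I) u) / 4

/-- The improper integral of `hardyKoshliakovKernel z x` over the real line. -/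
noncomputable def hardyKoshliakovValue (z : ℂ) (x : ℝ) : ℂ :=
  (macdonaldImproper z (x * Complex.I) Complex.I + macdonaldImproper z (x * Complex.I) (-Complex.I) +
    macdonaldImproper z (-(x * Complex.I)) Complex.I +
      macdonaldImproper z (-(x * Complex.I)) (-Complex.I)) / 4

theorem hardyKoshliakovKernel_log (z : ℂ) (x : ℝ) {t : ℝ} (ht : 0 < t) :
    t⁻¹ • hardyKoshliakovKernel z x (Real.log t) =
      (t : ℂ) ^ (z - ((1 : ℕ) : ℂ)) * (Real.cos (x * t) : ℂ) * (Real.cos (1 / t ^ 1) : ℂ) := by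
  have ht0 : (t : ℂ) ≠ 0 := by exact_mod_cast ht.ne'
  have h1 : Complex.exp (Real.log t : ℂ) = t := by rw [← Complex.ofReal_exp, Real.exp_log ht]
  have h2 : Complex.exp (-(Real.log t : ℂ)) = (t : ℂ)⁻¹ := by rw [Complex.exp_neg, h1]
  have h3 : Complex.exp (z * (Real.log t : ℂ)) = (t : ℂ) ^ z := by
    rw [Complex.cpow_def_of_ne_zero ht0, Complex.ofReal_log ht.le, mul_comm]
  simp only [hardyKoshliakovKernel, macdonaldKernel, h1, h2]
  rw [Nat.cast_one, Complex.cpow_sub _ _ ht0, Complex.cpow_one, ← h3, Complex.real_smul]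
  push_cast
  rw [Complex.cos, Complex.cos]
  simp only [sub_eq_add_neg, Complex.exp_add]
  have e1 : -((x : ℂ) * Complex.I * t) = -((x : ℂ) * t) * Complex.I := by ring
  have e2 : -(-((x : ℂ) * Complex.I) * t) = (x : ℂ) * t * Complex.I := by ring
  have e3 : -(Complex.I * (t : ℂ)⁻¹) = -(1 / (t : ℂ) ^ 1) * Complex.I := by
    rw [pow_one]; ring
  have e4 : -(-Complex.I * (t : ℂ)⁻¹) = 1 / (t : ℂ) ^ 1 * Complex.I := by
    rw [pow_one]; ring
  rw [e1, e2, e3, e4]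
  ring

theorem hardyKoshliakovPartial_one {z : ℂ} {x ε R : ℝ} (hε : 0 < ε) (hR : 0 < R) :
    hardyKoshliakovPartial 1 z x (ε, R) =
      ∫ u in Real.log ε..Real.log R, hardyKoshliakovKernel z x u := by
  have hpos : ∀ t ∈ Set.uIcc ε R, 0 < t := fun t ht =>
    (lt_min hε hR).trans_le (Set.mem_Icc.1 ht).1
  have hc : Continuous (hardyKoshliakovKernel z x) := by
    unfold hardyKoshliakovKernel macdonaldKernel
    fun_prop
  rw [← intervalIntegral.integral_deriv_smul_comp
    (fun t ht => Real.hasDerivAt_log (hpos t ht).ne')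
    (continuousOn_id.inv₀ fun t ht => (hpos t ht).ne') hc]
  refine intervalIntegral.integral_congr fun t ht => ?_
  exact (hardyKoshliakovKernel_log z x (hpos t ht)).symm

theorem tendsto_hardyKoshliakovPartial_one {z : ℂ} (h1 : -1 < z.re) (h2 : z.re < 1) {x : ℝ}
    (hx : 0 < x) :
    Tendsto (hardyKoshliakovPartial 1 z x) (𝓝[>] (0 : ℝ) ×ˢ atTop)
      (𝓝 (hardyKoshliakovValue z x)) := by
  have hx0 : (x : ℂ) ≠ 0 := by exact_mod_cast hx.ne'
  have hp0 : (x : ℂ) * Complex.I ≠ 0 := mul_ne_zero hx0 Complex.I_ne_zero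
  have hI := Complex.I_ne_zero
  have hlog : Tendsto (fun w : ℝ × ℝ => (Real.log w.1, Real.log w.2))
      (𝓝[>] (0 : ℝ) ×ˢ atTop) (atBot ×ˢ atTop) :=
    Real.tendsto_log_nhdsGT_zero.prodMap Real.tendsto_log_atTop
  have T : ∀ p q : ℂ, p.re = 0 → p ≠ 0 → q.re = 0 → q ≠ 0 → _ := fun p q a b c d =>
    (tendsto_integral_macdonaldKernel h1 h2 (p := p) (q := q) a.ge b c.ge d).comp hlog
  have h := ((((T (x * Complex.I) Complex.I (by simp) hp0 (by simp) hI).add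
    (T (x * Complex.I) (-Complex.I) (by simp) hp0 (by simp) (neg_ne_zero.2 hI))).add
    (T (-(x * Complex.I)) Complex.I (by simp) (neg_ne_zero.2 hp0) (by simp) hI)).add
    (T (-(x * Complex.I)) (-Complex.I) (by simp) (neg_ne_zero.2 hp0) (by simp)
      (neg_ne_zero.2 hI))).div_const 4
  refine h.congr' ?_
  have hev : ∀ᶠ w : ℝ × ℝ in 𝓝[>] (0 : ℝ) ×ˢ atTop, 0 < w.1 ∧ 0 < w.2 :=
    (eventually_mem_nhdsWithin (a := (0 : ℝ)) (s := Set.Ioi 0)).prod_mk (eventually_gt_atTop (0 : ℝ))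
  filter_upwards [hev] with w hw
  rw [hardyKoshliakovPartial_one hw.1 hw.2]
  have hi : ∀ p q : ℂ, IntervalIntegrable (macdonaldKernel z p q) volume (Real.log w.1)
      (Real.log w.2) := fun p q => (continuous_macdonaldKernel z p q).intervalIntegrable _ _
  simp only [hardyKoshliakovKernel, Function.comp_apply]
  rw [intervalIntegral.integral_div, intervalIntegral.integral_add, intervalIntegral.integral_add,
    intervalIntegral.integral_add (hi _ _) (hi _ _)]
  · exact (hi _ _).add (hi _ _)
  · exact hi _ _
  · exact ((hi _ _).add (hi _ _)).add (hi _ _)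
  · exact hi _ _

theorem tendsto_hardyKoshliakovValue_zero {x : ℝ} (hx : 0 < x) :
    Tendsto (fun z => hardyKoshliakovValue z x) (𝓝[≠] 0) (𝓝 (hardyKoshliakovValue 0 x)) := by
  have hx0 : (x : ℂ) ≠ 0 := by exact_mod_cast hx.ne'
  have hp0 : (x : ℂ) * Complex.I ≠ 0 := mul_ne_zero hx0 Complex.I_ne_zero
  have hI := Complex.I_ne_zero
  have T : ∀ p q : ℂ, p.re = 0 → p ≠ 0 → q.re = 0 → q ≠ 0 → _ := fun p q a b c d =>
    tendsto_macdonaldImproper_zero (p := p) (q := q) a.ge b c.ge d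
  exact ((((T (x * Complex.I) Complex.I (by simp) hp0 (by simp) hI).add
    (T (x * Complex.I) (-Complex.I) (by simp) hp0 (by simp) (neg_ne_zero.2 hI))).add
    (T (-(x * Complex.I)) Complex.I (by simp) (neg_ne_zero.2 hp0) (by simp) hI)).add
    (T (-(x * Complex.I)) (-Complex.I) (by simp) (neg_ne_zero.2 hp0) (by simp)
      (neg_ne_zero.2 hI))).div_const 4

theorem mul_I_cpow {x : ℝ} (hx : 0 < x) (ν : ℂ) :
    ((x : ℂ) * Complex.I) ^ ν = (x : ℂ) ^ ν * Complex.exp (Real.pi * ν / 2 * Complex.I) := by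
  have hx0 : (x : ℂ) ≠ 0 := by exact_mod_cast hx.ne'
  rw [Complex.cpow_def_of_ne_zero (mul_ne_zero hx0 Complex.I_ne_zero),
    Complex.cpow_def_of_ne_zero hx0, Complex.log_ofReal_mul hx Complex.I_ne_zero, Complex.log_I,
    Complex.ofReal_log hx.le, ← Complex.exp_add]
  congr 1
  ring

theorem neg_mul_I_cpow {x : ℝ} (hx : 0 < x) (ν : ℂ) :
    (-((x : ℂ) * Complex.I)) ^ ν =
      (x : ℂ) ^ ν * Complex.exp (-(Real.pi * ν / 2) * Complex.I) := by
  have hx0 : (x : ℂ) ≠ 0 := by exact_mod_cast hx.ne'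
  rw [← mul_neg, Complex.cpow_def_of_ne_zero (mul_ne_zero hx0 (neg_ne_zero.2 Complex.I_ne_zero)),
    Complex.cpow_def_of_ne_zero hx0, Complex.log_ofReal_mul hx (neg_ne_zero.2 Complex.I_ne_zero),
    Complex.log_neg_I, Complex.ofReal_log hx.le, ← Complex.exp_add]
  congr 1
  ring

/-- Each of `p q = x` and `p q = -x` occurs twice, with opposite phases `exp (± i π z / 2)`, which
add up to `2 cos (π z / 2)`. -/
theorem hardyKoshliakovValue_eq_series {z : ℂ} (h1 : -1 < z.re) (h2 : z.re < 1) (hz : z ≠ 0)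
    {x : ℝ} (hx : 0 < x) :
    hardyKoshliakovValue z x = Real.pi / 2 * (Complex.cos (Real.pi * z / 2) /
      Complex.sin (Real.pi * z)) *
        ((x : ℂ) ^ (-z) * (besselClifford (-z) x + besselClifford (-z) (-x)) -
          (besselClifford z x + besselClifford z (-x))) := by
  have hx0 : (x : ℂ) ≠ 0 := by exact_mod_cast hx.ne'
  have hp0 : (x : ℂ) * Complex.I ≠ 0 := mul_ne_zero hx0 Complex.I_ne_zero
  have hI := Complex.I_ne_zero
  have T : ∀ p q : ℂ, p.re = 0 → p ≠ 0 → q.re = 0 → q ≠ 0 →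
      macdonaldImproper z p q = macdonaldSeries z p q := fun p q a b c d =>
    macdonaldTail_add_tail_eq_series h1 h2 hz a.ge b c.ge d
  have i1 : Complex.I ^ z = Complex.exp (Real.pi * z / 2 * Complex.I) := by
    simpa using mul_I_cpow one_pos z
  have i2 : (-Complex.I) ^ z = Complex.exp (-(Real.pi * z / 2) * Complex.I) := by
    simpa using neg_mul_I_cpow one_pos z
  have m1 : (x : ℂ) * Complex.I * Complex.I = -x := by rw [mul_assoc, Complex.I_mul_I]; ring
  rw [hardyKoshliakovValue, T _ _ (by simp) hp0 (by simp) hI,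
    T _ _ (by simp) hp0 (by simp) (neg_ne_zero.2 hI),
    T _ _ (by simp) (neg_ne_zero.2 hp0) (by simp) hI,
    T _ _ (by simp) (neg_ne_zero.2 hp0) (by simp) (neg_ne_zero.2 hI)]
  simp only [macdonaldSeries, mul_I_cpow hx, neg_mul_I_cpow hx, i1, i2, mul_neg, neg_mul, m1,
    neg_neg, neg_div]
  rw [Complex.cos]
  simp only [neg_mul]
  ring

/-! ### The limits defining `Y_0` and `K_0` -/

theorem differentiableAt_besselJ_order {ν : ℂ} (hν : -1 < ν.re) {ξ : ℂ} (hξ : ξ ≠ 0) :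
    DifferentiableAt ℂ (fun μ => besselJ μ ξ) ν := by
  simp only [fun μ => besselJ_eq_besselClifford μ hξ]
  exact (differentiableAt_id.const_cpow (Or.inl (div_ne_zero hξ two_ne_zero))).mul
    (differentiableAt_besselClifford_order hν _)

theorem differentiableAt_besselI_order {ν : ℂ} (hν : -1 < ν.re) {y : ℝ} (hy : 0 < y) :
    DifferentiableAt ℂ (fun μ => besselI μ y) ν := by
  have hy0 : (y : ℂ) ≠ 0 := by exact_mod_cast hy.ne'
  simp only [fun μ => besselI_eq_besselClifford μ hy]
  exact (differentiableAt_id.const_cpow (Or.inl (div_ne_zero hy0 two_ne_zero))).mul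
    (differentiableAt_besselClifford_order hν _)

/-- A quotient of two difference quotients at `0`, with limit `N'(0) / π`. -/
theorem exists_tendsto_div_sin_pi_mul {N : ℂ → ℂ} (hN : DifferentiableAt ℂ N 0) (h0 : N 0 = 0) :
    ∃ l, Tendsto (fun μ => N μ / Complex.sin (Real.pi * μ)) (𝓝[≠] 0) (𝓝 l) := by
  have hpi : (Real.pi : ℂ) ≠ 0 := by exact_mod_cast Real.pi_ne_zero
  have hs : HasDerivAt (fun μ : ℂ => Complex.sin (Real.pi * μ)) Real.pi 0 := by
    have := ((hasDerivAt_id (0 : ℂ)).const_mul (Real.pi : ℂ)).csin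
    simpa using this
  refine ⟨deriv N 0 / Real.pi, ((hN.hasDerivAt.tendsto_slope).div hs.tendsto_slope hpi).congr' ?_⟩
  filter_upwards [self_mem_nhdsWithin] with μ hμ
  have hμ0 : μ ≠ 0 := hμ
  simp only [Pi.div_apply, slope_def_field, h0, sub_zero, mul_zero, Complex.sin_zero]
  rw [div_div_div_cancel_right₀ hμ0]

theorem tendsto_besselYQuot_zero {y : ℝ} (hy : 0 < y) :
    Tendsto (fun μ => besselYQuot μ y) (𝓝[≠] 0) (𝓝 (besselY 0 y)) := by
  have hy0 : (y : ℂ) ≠ 0 := by exact_mod_cast hy.ne'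
  have hJ := differentiableAt_besselJ_order (ν := 0) (by simp) hy0
  have hJ' : DifferentiableAt ℂ (fun μ => besselJ (-μ) y) 0 :=
    DifferentiableAt.comp (0 : ℂ) (g := fun μ => besselJ μ y) (by simpa using hJ)
      differentiableAt_id.neg
  obtain ⟨l, hl⟩ := exists_tendsto_div_sin_pi_mul
    (N := fun μ => besselJ μ y * Complex.cos (Real.pi * μ) - besselJ (-μ) y)
    ((hJ.mul (differentiableAt_id.const_mul _).ccos).sub hJ') (by simp)
  have h : besselY 0 y = l := by
    rw [besselY, if_pos ⟨0, by simp⟩]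
    exact hl.limUnder_eq
  rw [h]
  exact hl

theorem tendsto_besselKQuot_zero {y : ℝ} (hy : 0 < y) :
    Tendsto (fun μ => besselKQuot μ y) (𝓝[≠] 0) (𝓝 (besselK 0 y)) := by
  have hI := differentiableAt_besselI_order (ν := 0) (by simp) hy
  have hI' : DifferentiableAt ℂ (fun μ => besselI (-μ) y) 0 :=
    DifferentiableAt.comp (0 : ℂ) (g := fun μ => besselI μ y) (by simpa using hI)
      differentiableAt_id.neg
  obtain ⟨l, hl⟩ := exists_tendsto_div_sin_pi_mul
    (N := fun μ => besselI (-μ) y - besselI μ y) (hI'.sub hI) (by simp)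
  have hl' := hl.const_mul ((Real.pi : ℂ) / 2)
  have h : besselK 0 y = Real.pi / 2 * l := by
    rw [besselK, if_pos ⟨0, by simp⟩]
    exact hl'.limUnder_eq
  rw [h]
  exact hl'

/-! ### Comparison with the Bessel quotients and conclusion -/

/-- The right-hand side of the evaluation of `H_z^{(1)}(x)`, with the defining quotients in place of
`Y_z` and `K_z`. -/
noncomputable def hardyKoshliakovQuot (z : ℂ) (x : ℝ) : ℂ :=
  (Real.pi / 2) * (x : ℂ) ^ (-z / 2) *
    (Complex.cos (Real.pi * z / 2) *
      ((2 / Real.pi) * besselKQuot z ((2 * Real.sqrt x : ℝ) : ℂ) -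
        besselYQuot z ((2 * Real.sqrt x : ℝ) : ℂ)) -
      Complex.sin (Real.pi * z / 2) * besselJ z ((2 * Real.sqrt x : ℝ) : ℂ))

theorem hardyKoshliakovValue_eq_quot {z : ℂ} (h1 : -1 < z.re) (h2 : z.re < 1) (hz : z ≠ 0)
    {x : ℝ} (hx : 0 < x) : hardyKoshliakovValue z x = hardyKoshliakovQuot z x := by
  have hs := sin_pi_mul_ne_zero_of_re h1 h2 hz
  have hpi : (Real.pi : ℂ) ≠ 0 := by exact_mod_cast Real.pi_ne_zero
  have hr : 0 < Real.sqrt x := Real.sqrt_pos.2 hx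
  have hr0 : (Real.sqrt x : ℂ) ≠ 0 := by exact_mod_cast hr.ne'
  have hy : 0 < 2 * Real.sqrt x := by positivity
  have hy0 : ((2 * Real.sqrt x : ℝ) : ℂ) ≠ 0 := by exact_mod_cast hy.ne'
  have hhalf : ((2 * Real.sqrt x : ℝ) : ℂ) / 2 = (Real.sqrt x : ℂ) := by push_cast; ring
  have hsq : (Real.sqrt x : ℂ) ^ 2 = x := by
    rw [← Complex.ofReal_pow, Real.sq_sqrt hx.le]
  have hX : (Real.sqrt x : ℂ) ^ z ≠ 0 := by
    rw [Complex.cpow_def_of_ne_zero hr0]; exact Complex.exp_ne_zero _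
  have hx2 : (x : ℂ) = (Real.sqrt x : ℂ) * (Real.sqrt x : ℂ) := by rw [← sq, hsq]
  have c1 : (x : ℂ) ^ (-z) = ((Real.sqrt x : ℂ) ^ z)⁻¹ * ((Real.sqrt x : ℂ) ^ z)⁻¹ := by
    rw [hx2, Complex.mul_cpow_ofReal_nonneg hr.le hr.le, Complex.cpow_neg]
  have c2 : (x : ℂ) ^ (-z / 2) = ((Real.sqrt x : ℂ) ^ z)⁻¹ := by
    rw [hx2, Complex.mul_cpow_ofReal_nonneg hr.le hr.le, ← Complex.cpow_add _ _ hr0, add_halves,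
      Complex.cpow_neg]
  have s1 : Complex.sin (Real.pi * z) =
      2 * Complex.sin (Real.pi * z / 2) * Complex.cos (Real.pi * z / 2) := by
    rw [← Complex.sin_two_mul]; congr 1; ring
  have s2 : Complex.cos (Real.pi * z) = 2 * Complex.cos (Real.pi * z / 2) ^ 2 - 1 := by
    rw [← Complex.cos_two_mul]; congr 1; ring
  have s3 := Complex.sin_sq_add_cos_sq (Real.pi * z / 2)
  -- This is `cos (2θ - θ) = cos θ` with `θ = π z / 2`; it merges the `J_z` inside `Y_z` with the
  -- separate `J_z` term.
  have key : Complex.sin (Real.pi * z) * Complex.sin (Real.pi * z / 2) +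
      Complex.cos (Real.pi * z / 2) * Complex.cos (Real.pi * z) =
        Complex.cos (Real.pi * z / 2) := by
    rw [s1, s2]
    linear_combination 2 * Complex.cos (Real.pi * z / 2) * s3
  rw [hardyKoshliakovValue_eq_series h1 h2 hz hx, hardyKoshliakovQuot, besselKQuot, besselYQuot,
    besselI_eq_besselClifford _ hy, besselI_eq_besselClifford _ hy,
    besselJ_eq_besselClifford _ hy0, besselJ_eq_besselClifford _ hy0, hhalf, hsq, c1, c2,
    Complex.cpow_neg]
  field_simp
  linear_combination ((Real.sqrt x : ℂ) ^ z * (Real.sqrt x : ℂ) ^ z * besselClifford z (-x)) * key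

theorem tendsto_hardyKoshliakovQuot_zero {x : ℝ} (hx : 0 < x) :
    Tendsto (fun z => hardyKoshliakovQuot z x) (𝓝[≠] 0)
      (𝓝 ((Real.pi / 2) * (x : ℂ) ^ (-(0 : ℂ) / 2) *
        (Complex.cos (Real.pi * 0 / 2) * besselM 0 ((2 * Real.sqrt x : ℝ) : ℂ) -
          Complex.sin (Real.pi * 0 / 2) * besselJ 0 ((2 * Real.sqrt x : ℝ) : ℂ)))) := by
  have hx0 : (x : ℂ) ≠ 0 := by exact_mod_cast hx.ne'
  have hy : 0 < 2 * Real.sqrt x := by have := Real.sqrt_pos.2 hx; positivity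
  have hy0 : ((2 * Real.sqrt x : ℝ) : ℂ) ≠ 0 := by exact_mod_cast hy.ne'
  have t1 : Tendsto (fun z : ℂ => (x : ℂ) ^ (-z / 2)) (𝓝[≠] 0) (𝓝 ((x : ℂ) ^ (-(0 : ℂ) / 2))) := by
    have : Continuous fun z : ℂ => (x : ℂ) ^ (-z / 2) :=
      Continuous.const_cpow (by fun_prop) (Or.inl hx0)
    exact (this.tendsto 0).mono_left nhdsWithin_le_nhds
  have t2 : Tendsto (fun z : ℂ => Complex.cos (Real.pi * z / 2)) (𝓝[≠] 0)
      (𝓝 (Complex.cos (Real.pi * 0 / 2))) := by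
    have : Continuous fun z : ℂ => Complex.cos (Real.pi * z / 2) := by fun_prop
    exact (this.tendsto 0).mono_left nhdsWithin_le_nhds
  have t3 : Tendsto (fun z : ℂ => Complex.sin (Real.pi * z / 2)) (𝓝[≠] 0)
      (𝓝 (Complex.sin (Real.pi * 0 / 2))) := by
    have : Continuous fun z : ℂ => Complex.sin (Real.pi * z / 2) := by fun_prop
    exact (this.tendsto 0).mono_left nhdsWithin_le_nhds
  have t4 : Tendsto (fun z : ℂ => besselJ z ((2 * Real.sqrt x : ℝ) : ℂ)) (𝓝[≠] 0)
      (𝓝 (besselJ 0 ((2 * Real.sqrt x : ℝ) : ℂ))) :=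
    (differentiableAt_besselJ_order (ν := 0) (by simp) hy0).continuousAt.tendsto.mono_left
      nhdsWithin_le_nhds
  exact (t1.const_mul _).mul ((t2.mul (((tendsto_besselKQuot_zero hy).const_mul _).sub
    (tendsto_besselYQuot_zero hy))).sub (t3.mul t4))

/-- The improper integral defining `H_z^{(1)}(x)` converges (first conjunct), and it has the stated
value (second conjunct). -/
theorem mainTheorem12 (z : ℂ) (hz₁ : -1 < z.re) (hz₂ : z.re < 1) (x : ℝ) (hx : 0 < x) :
    Tendsto (hardyKoshliakovPartial 1 z x) (𝓝[>] (0 : ℝ) ×ˢ atTop) (𝓝 (hardyKoshliakovH 1 z x)) ∧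
    hardyKoshliakovH 1 z x =
      (Real.pi / 2) * (x : ℂ) ^ (-z / 2) *
        (Complex.cos (Real.pi * z / 2) * besselM z ((2 * Real.sqrt x : ℝ) : ℂ) -
          Complex.sin (Real.pi * z / 2) * besselJ z ((2 * Real.sqrt x : ℝ) : ℂ)) := by
  have hlim := tendsto_hardyKoshliakovPartial_one hz₁ hz₂ hx
  have hH : hardyKoshliakovH 1 z x = hardyKoshliakovValue z x := hlim.limUnder_eq
  rw [hH]
  refine ⟨hlim, ?_⟩
  -- Zero is the only integer in the strip, hence the only order at which `Y` and `K` are defined by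
  -- limits.
  rcases eq_or_ne z 0 with rfl | hz
  · refine tendsto_nhds_unique (tendsto_hardyKoshliakovValue_zero hx)
      ((tendsto_hardyKoshliakovQuot_zero hx).congr' ?_)
    have hre : ∀ᶠ z : ℂ in 𝓝[≠] 0, z.re ∈ Set.Ioo (-1 : ℝ) 1 :=
      nhdsWithin_le_nhds ((Complex.continuous_re.tendsto 0).eventually
        (Ioo_mem_nhds (by simp) (by simp)))
    filter_upwards [hre, self_mem_nhdsWithin] with w hw hw0
    exact (hardyKoshliakovValue_eq_quot hw.1 hw.2 hw0 hx).symm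
  · have hint : ¬ ∃ n : ℤ, z = n := by
      rintro ⟨n, rfl⟩
      refine sin_pi_mul_ne_zero_of_re hz₁ hz₂ hz ?_
      rw [mul_comm]
      exact Complex.sin_int_mul_pi n
    rw [hardyKoshliakovValue_eq_quot hz₁ hz₂ hz hx, hardyKoshliakovQuot, besselM, besselK,
      besselY, if_neg hint, if_neg hint]
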